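/- Let $\mathbb N=\{0,1,2,\dots\}$ and let $G=\prod_{k\in\mathbb N}Z_2$ be the dyadic group, with normalized Haar measure $\mu$. For $x\in G$ let $I_n(x)=\{y\in G: y_j=x_j \text{ for all } j<n\}$, and let $\zeta_n$ be the $\sigma$-algebra generated by the sets $I_n(x)$, $x\in G$. For $n=\sum_{k\ge 0}n_k2^k$ with binary digits $n_k\in\{0,1\}$, let $w_n(x)=(-1)^{\sum_k n_kx_k}$ be the $n$-th Walsh function, let $D_n=\sum_{k=0}^{n-1}w_k$ be the $n$-th Dirichlet kernel, and let $V(n)=n_0+\sum_{k\ge 1}|n_k-n_{k-1}|$ be the binary variation of $n$. For a real- or complex-valued martingale $F=(F_n)_{n\in\mathbb N}$ with respect to $(\zeta_n)_{n\in\mathbb N}$, put $$\widehat F(k)=\lim_{n\to\infty}\int_G F_nw_k\,d\mu,\qquad S_nF=\sum_{k=0}^{n-1}\widehat F(k)w_k,\qquad \|F\|_{H_1}=\int_G\sup_{n\in\mathbb N}|F_n|\,d\mu ,$$ and let $H_1(G)$ be the space of all such martingales with $\|F\|_{H_1}<\infty$. A function $f\in L_1(G)$ is identified with the martingale $(E[f\mid\zeta_n])_{n\in\mathbb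 N}$. For a sequence $(n_k)_{k\in\mathbb N}$ of positive integers, put $$\widetilde S^{*,\nabla}F=\sup_{k\in\mathbb N}\frac{|S_{n_k}F|}{V(n_k)} .$$ a) There is an absolute constant $C$ such that, for every sequence $(n_k)$ of positive integers and every $F\in H_1(G)$, $$\sup_{t>0}\,t\,\mu\{x\in G:\widetilde S^{*,\nabla}F(x)>t\}\le C\,\|F\|_{H_1},$$ that is, $\widetilde S^{*,\nabla}$ is bounded from $H_1(G)$ to weak-$L_1(G)$. b) If $(n_k)$ runs through all positive integers, that is, $\{n_k:k\in\mathbb N\}=\{1,2,3,\dots\}$, then $\widetilde S^{*,\nabla}$ is not bounded from $H_1(G)$ to $L_1(G)$: there is no constant $C$ such that $\|\widetilde S^{*,\nabla}F\|_1\le C\|F\|_{H_1}$ for all $F\in H_1(G)$. In fact, for every $m\in\mathbb N$ the martingale $f_m=D_{2^{m+1}}-D_{2^m}$ belongs to $H_1(G)$ and $\|f_m\|_{H_1}>0$, and $$\frac{\|\widetilde S^{*,\nabla}f_m\|_1}{\|f_m\|_{H_1}}\to\infty\qquad\text{as } m\to\infty .$$ -/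

import Mathlib

open MeasureTheory Filter Topology
open scoped ENNReal NNReal

namespace WalshHardy

noncomputable section

/-- The dyadic group: the complete direct product of countably many copies of `Z₂`. -/
abbrev G : Type := ℕ → ZMod 2

/-- The normalized Haar measure on `Z₂`: each singleton has measure `1 / 2`. -/
def μ₂ : Measure (ZMod 2) := (PMF.uniformOfFintype (ZMod 2)).toMeasure

instance : IsProbabilityMeasure μ₂ := by unfold μ₂; infer_instance

/-- The normalized Haar measure on `G`: the product of the Haar measures of the factors. -/
def μ : Measure G := Measure.infinitePi fun _ => μ₂

instance : IsProbabilityMeasure μ := by unfold μ; infer_instance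

/-- The dyadic interval `I_n(x)`. -/
def I (n : ℕ) (x : G) : Set G := {y | ∀ j < n, y j = x j}

lemma measurableSet_I (n : ℕ) (x : G) : MeasurableSet (I n x) := by
  have h : I n x = ⋂ j ∈ Set.Iio n, (fun y : G => y j) ⁻¹' {x j} := by
    ext y; simp [I]
  rw [h]
  exact MeasurableSet.biInter (Set.to_countable _) fun j _ =>
    measurable_pi_apply j (measurableSet_singleton _)

lemma finite_range_I (n : ℕ) : (Set.range (I n)).Finite := by
  refine (Set.finite_range (fun a : Fin n → ZMod 2 => {y : G | ∀ j : Fin n, y j = a j})).subset ?_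
  rintro _ ⟨x, rfl⟩
  refine ⟨fun j => x j, ?_⟩
  ext y
  exact ⟨fun h j hj => h ⟨j, hj⟩, fun h j => h j j.2⟩

/-- The filtration `(ζ_n)`: `ζ_n` is the `σ`-algebra generated by the dyadic intervals `I_n(x)`. -/
def ζ : Filtration ℕ (inferInstance : MeasurableSpace G) where
  seq n := MeasurableSpace.generateFrom (Set.range (I n))
  mono' := by
    intro m n hmn
    refine MeasurableSpace.generateFrom_le ?_
    rintro _ ⟨x, rfl⟩
    have h : I m x = ⋃₀ (I n '' I m x) := by
      ext y
      constructor
      · exact fun hy => ⟨I n y, ⟨y, hy, rfl⟩, fun _ _ => rfl⟩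
      · rintro ⟨_, ⟨z, hz, rfl⟩, hy⟩ j hj
        rw [hy j (hj.trans_le hmn), hz j hj]
    rw [h]
    refine MeasurableSet.sUnion
      ((finite_range_I n).subset (Set.image_subset_range _ _)).countable ?_
    rintro _ ⟨z, -, rfl⟩
    exact MeasurableSpace.measurableSet_generateFrom ⟨z, rfl⟩
  le' n := by
    refine MeasurableSpace.generateFrom_le ?_
    rintro _ ⟨x, rfl⟩
    exact measurableSet_I n x

/-- The `k`-th binary digit of `n`. -/
def digit (n k : ℕ) : ℕ := n / 2 ^ k % 2

/-- The binary variation `V(n) = n_0 + ∑_{k ≥ 1} |n_k - n_{k-1}|`. As `n < 2 ^ n`, the digits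
`n_k` with `k ≥ n` vanish, so the sum may be restricted to `1 ≤ k ≤ n`. -/
def V (n : ℕ) : ℕ :=
  digit n 0 + ∑ k ∈ Finset.range n, ((digit n (k + 1) : ℤ) - (digit n k : ℤ)).natAbs

/-- The Rademacher function `r_k(x) = (-1) ^ {x_k}`. -/
def rademacher (k : ℕ) (x : G) : ℝ := (-1) ^ (x k).val

/-- The Walsh function `w_n = ∏_k r_k ^ {n_k}`; the factors with `k ≥ n` equal `1`. -/
def walsh (n : ℕ) (x : G) : ℝ := ∏ k ∈ Finset.range n, rademacher k x ^ digit n k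

/-- The Dirichlet kernel `D_n = ∑_{k < n} w_k`. -/
def dirichlet (n : ℕ) (x : G) : ℝ := ∑ k ∈ Finset.range n, walsh k x

variable {𝕜 : Type*} [RCLike 𝕜]

/-- The `k`-th Walsh–Fourier coefficient of a martingale `F`: the limit of `∫ F_n w_k dμ`
as `n → ∞`. -/
def fourierCoeff (F : ℕ → G → 𝕜) (k : ℕ) : 𝕜 :=
  limUnder atTop fun n => ∫ x, F n x * (walsh k x : 𝕜) ∂μ

/-- The `n`-th partial sum of the Walsh–Fourier series of a martingale. -/
def partialSum (n : ℕ) (F : ℕ → G → 𝕜) (x : G) : 𝕜 :=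
  ∑ k ∈ Finset.range n, fourierCoeff F k * (walsh k x : 𝕜)

/-- `‖F‖_{H_1} = ‖F^*‖_1`, where `F^* = sup_n |F_n|`. -/
def hardyNorm (F : ℕ → G → 𝕜) : ℝ≥0∞ := ∫⁻ x, ⨆ n, ‖F n x‖ₑ ∂μ

/-- `F` belongs to the martingale Hardy space `H_1(G)`. -/
def MemH1 (F : ℕ → G → 𝕜) : Prop := Martingale F ζ μ ∧ hardyNorm F < ∞

/-- The weighted maximal operator `sup_k |S_{n_k} F| / V(n_k)`. -/
def weightedMaximal (n : ℕ → ℕ) (F : ℕ → G → 𝕜) (x : G) : ℝ≥0∞ :=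
  ⨆ k, ‖partialSum (n k) F x‖ₑ / (V (n k) : ℝ≥0∞)

/-- The weak-`L_1` quasinorm `sup_{t > 0} t μ{g > t}` of a nonnegative function. -/
def weakL1Norm (g : G → ℝ≥0∞) : ℝ≥0∞ := ⨆ t : ℝ≥0, (t : ℝ≥0∞) * μ {x | (t : ℝ≥0∞) < g x}

/-- The function `D_{2^{m+1}} - D_{2^m}`, regarded as the martingale of its conditional
expectations with respect to `(ζ_n)`. -/
def dirichletDiff (𝕜 : Type*) [RCLike 𝕜] (m : ℕ) : ℕ → G → 𝕜 :=
  fun n => μ[fun x => ((dirichlet (2 ^ (m + 1)) x - dirichlet (2 ^ m) x : ℝ) : 𝕜) | ζ n]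

end

end WalshHardy

open WalshHardy

/-! a) Expanding along binary digits gives `w_n D_n = ∑ n_k (D_{2^{k+1}} - D_{2^k})`, and Abel
summation turns this into a bound of `|D_n|` by dyadic kernels `D_{2^k}` of total weight `V(n)`
(`abs_dirichlet_le`). Since `D_{2^k} = 2^k` on `I_k(0)` and `0` elsewhere, convolution with it is
averaging over `I_k(x)`. Hence `|S_n F| ≤ V(n) M(F^*)`, with `M` the dyadic maximal operator
(`enorm_partialSum_le`), and the weak type (1,1) inequality for `M` gives the claim with `C = 1`.

b) `f_m = r_m D_{2^m}` has Hardy norm `1`. For `i < m`, `S_{2^m+2^i} f_m = r_m D_{2^i}`, while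
`V(2^m+2^i) ≤ 4`. So the maximal function dominates `D_{2^i}/4` for every `i < m`; each of the
disjoint shells `I_i(0) \ I_{i+1}(0)` contributes at least `1/8` to its integral, in total at least
`m/8`. -/

namespace WalshHardy

/-! ### Walsh functions and pointwise bounds for Dirichlet kernels. -/

section Kernel

lemma digit_zero (n : ℕ) : digit n 0 = n % 2 := by simp [digit]

lemma digit_succ (n k : ℕ) : digit n (k + 1) = digit (n / 2) k := by
  simp [digit, Nat.div_div_eq_div_mul, pow_succ']

lemma digit_eq_zero {n k : ℕ} (h : n < 2 ^ k) : digit n k = 0 := by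
  simp [digit, Nat.div_eq_of_lt h]

lemma rademacher_eq_ite (k : ℕ) (x : G) : rademacher k x = if x k = 0 then 1 else -1 := by
  unfold rademacher
  generalize x k = a
  revert a
  change ∀ a : Fin 2, (-1 : ℝ) ^ a.val = if a = 0 then 1 else -1
  intro a
  fin_cases a <;> simp

lemma rademacher_mul_self (k : ℕ) (x : G) : rademacher k x * rademacher k x = 1 := by
  rw [rademacher_eq_ite]; split_ifs <;> norm_num

lemma rademacher_add (k : ℕ) (x y : G) :
    rademacher k (x + y) = rademacher k x * rademacher k y := by
  have h : ∀ a b : Fin 2, (if a + b = 0 then (1 : ℝ) else -1) =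
      (if a = 0 then 1 else -1) * (if b = 0 then 1 else -1) := by
    intro a b
    fin_cases a <;> fin_cases b <;> simp
  rw [rademacher_eq_ite, rademacher_eq_ite, rademacher_eq_ite]
  exact h (x k) (y k)

/-- Digits past the binary length vanish, so the cut-off in `walsh` can be replaced by any
sufficient level; two indices can then be compared over a common range. -/
lemma walsh_eq_prod {n K : ℕ} (h : n < 2 ^ K) (x : G) :
    walsh n x = ∏ k ∈ Finset.range K, rademacher k x ^ digit n k := by
  have key : ∀ {L M : ℕ}, n < 2 ^ L → L ≤ M → ∏ k ∈ Finset.range L, rademacher k x ^ digit n k =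
      ∏ k ∈ Finset.range M, rademacher k x ^ digit n k := by
    intro L M hL hLM
    refine Finset.prod_subset (Finset.range_mono hLM) fun k _ hk => ?_
    rw [Finset.mem_range, not_lt] at hk
    rw [digit_eq_zero (hL.trans_le (Nat.pow_le_pow_right two_pos hk)), pow_zero]
  rw [walsh, key Nat.lt_two_pow_self (le_max_left n K), key h (le_max_right n K)]

lemma walsh_zero (x : G) : walsh 0 x = 1 := by simp [walsh]

lemma walsh_mul_self (n : ℕ) (x : G) : walsh n x * walsh n x = 1 := by
  rw [walsh, ← Finset.prod_mul_distrib]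
  refine Finset.prod_eq_one fun k _ => ?_
  rw [← mul_pow, rademacher_mul_self, one_pow]

lemma abs_walsh (n : ℕ) (x : G) : |walsh n x| = 1 := by
  rw [← abs_one, ← mul_self_inj (abs_nonneg _) (abs_nonneg _), abs_mul_abs_self,
    abs_mul_abs_self, walsh_mul_self, one_mul]

lemma walsh_add (n : ℕ) (x y : G) : walsh n (x + y) = walsh n x * walsh n y := by
  simp only [walsh, rademacher_add, mul_pow, Finset.prod_mul_distrib]

lemma rademacher_congr {n k : ℕ} {x y : G} (h : y ∈ I n x) (hk : k < n) :
    rademacher k y = rademacher k x := by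
  simp only [rademacher, h k hk]

lemma walsh_congr {n k : ℕ} {x y : G} (h : y ∈ I n x) (hk : k < 2 ^ n) :
    walsh k y = walsh k x := by
  rw [walsh_eq_prod hk, walsh_eq_prod hk]
  refine Finset.prod_congr rfl fun j hj => ?_
  rw [rademacher_congr h (Finset.mem_range.1 hj)]

/-- Peeling off the lowest digit shifts the group by one coordinate; this is the self-similarity
behind the inductions on Dirichlet kernels. -/
lemma walsh_eq_mul_shift (n : ℕ) (x : G) :
    walsh n x = rademacher 0 x ^ (n % 2) * walsh (n / 2) (fun j => x (j + 1)) := by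
  have h : n < 2 ^ (n + 1) := Nat.lt_two_pow_self.trans (Nat.pow_lt_pow_succ one_lt_two)
  have h' : n / 2 < 2 ^ n := (Nat.div_le_self _ _).trans_lt Nat.lt_two_pow_self
  rw [walsh_eq_prod h, walsh_eq_prod h', Finset.prod_range_succ', mul_comm, digit_zero]
  simp only [digit_succ]
  rfl

lemma walsh_two_pow (m : ℕ) (x : G) : walsh (2 ^ m) x = rademacher m x := by
  induction m generalizing x with
  | zero => rw [walsh_eq_mul_shift]; simp [walsh_zero]
  | succ m ih =>
    rw [walsh_eq_mul_shift, show 2 ^ (m + 1) % 2 = 0 by omega,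
      show 2 ^ (m + 1) / 2 = 2 ^ m by omega, ih]
    simp [rademacher]

lemma dirichlet_two_mul (n : ℕ) (x : G) :
    dirichlet (2 * n) x = (1 + rademacher 0 x) * dirichlet n (fun j => x (j + 1)) := by
  induction n with
  | zero => simp [dirichlet]
  | succ n ih =>
    have h : dirichlet (2 * (n + 1)) x =
        dirichlet (2 * n) x + walsh (2 * n) x + walsh (2 * n + 1) x := by
      simp only [dirichlet, mul_add, mul_one, Finset.sum_range_succ]
    rw [h, ih, walsh_eq_mul_shift (2 * n), walsh_eq_mul_shift (2 * n + 1),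
      show 2 * n % 2 = 0 by omega, show (2 * n + 1) % 2 = 1 by omega,
      show 2 * n / 2 = n by omega, show (2 * n + 1) / 2 = n by omega]
    simp only [dirichlet, Finset.sum_range_succ]
    ring

lemma dirichlet_two_mul_add_one (n : ℕ) (x : G) :
    dirichlet (2 * n + 1) x = (1 + rademacher 0 x) * dirichlet n (fun j => x (j + 1)) +
      walsh n (fun j => x (j + 1)) := by
  rw [← dirichlet_two_mul, dirichlet, Finset.sum_range_succ, walsh_eq_mul_shift (2 * n),
    show 2 * n % 2 = 0 by omega, show 2 * n / 2 = n by omega, pow_zero, one_mul]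
  rfl

/-- The dyadic Dirichlet kernel `D_{2^k}`, in product form. -/
noncomputable def dyadicKernel (k : ℕ) (x : G) : ℝ := ∏ j ∈ Finset.range k, (1 + rademacher j x)

lemma dyadicKernel_succ_shift (k : ℕ) (x : G) :
    dyadicKernel (k + 1) x = (1 + rademacher 0 x) * dyadicKernel k (fun j => x (j + 1)) := by
  rw [dyadicKernel, Finset.prod_range_succ', mul_comm]
  rfl

lemma dyadicKernel_eq_ite (k : ℕ) (x : G) :
    dyadicKernel k x = (I k 0).indicator (fun _ => (2 : ℝ) ^ k) x := by
  classical
  rw [Set.indicator_apply]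
  split_ifs with h
  · rw [dyadicKernel, ← Finset.card_range k, ← Finset.prod_const, Finset.card_range]
    refine Finset.prod_congr rfl fun j hj => ?_
    rw [rademacher_eq_ite, if_pos (show x j = 0 from h j (Finset.mem_range.1 hj))]
    norm_num
  · simp only [I, Set.mem_ofPred_eq, not_forall] at h
    obtain ⟨j, hj, hx⟩ := h
    refine Finset.prod_eq_zero (Finset.mem_range.2 hj) ?_
    rw [rademacher_eq_ite, if_neg (show ¬x j = 0 from hx)]
    norm_num

lemma dyadicKernel_nonneg (k : ℕ) (x : G) : 0 ≤ dyadicKernel k x := by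
  rw [dyadicKernel_eq_ite]
  exact Set.indicator_nonneg (fun _ _ => by positivity) _

lemma dirichlet_two_pow (k : ℕ) (x : G) : dirichlet (2 ^ k) x = dyadicKernel k x := by
  induction k generalizing x with
  | zero => simp [dirichlet, dyadicKernel, walsh_zero]
  | succ k ih => rw [pow_succ', dirichlet_two_mul, ih, dyadicKernel_succ_shift]

/-- The expansion of `w_n D_n` along the binary digits of `n`. -/
lemma walsh_mul_dirichlet {n K : ℕ} (h : n < 2 ^ K) (x : G) :
    walsh n x * dirichlet n x =
      ∑ k ∈ Finset.range K, (digit n k : ℝ) * (dyadicKernel (k + 1) x - dyadicKernel k x) := by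
  induction K generalizing n x with
  | zero => simp [show n = 0 by simpa using h, dirichlet]
  | succ K ih =>
    have hq : n / 2 < 2 ^ K := by rw [pow_succ] at h; omega
    have hr := rademacher_mul_self 0 x
    have hw := walsh_mul_self (n / 2) (fun j => x (j + 1))
    -- The terms `k ≥ 1` carry the common factor `1 + r_0` and reduce to the sum for `n / 2` at the
    -- shifted point; the term `k = 0` is `n_0 r_0`.
    have hT : ∑ k ∈ Finset.range (K + 1),
        (digit n k : ℝ) * (dyadicKernel (k + 1) x - dyadicKernel k x) =
        (1 + rademacher 0 x) * (walsh (n / 2) (fun j => x (j + 1)) *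
          dirichlet (n / 2) (fun j => x (j + 1))) + ((n % 2 : ℕ) : ℝ) * rademacher 0 x := by
      rw [Finset.sum_range_succ', ih hq, Finset.mul_sum, digit_zero]
      congr 1
      · refine Finset.sum_congr rfl fun k _ => ?_
        rw [digit_succ, dyadicKernel_succ_shift (k + 1) x, dyadicKernel_succ_shift k x]
        ring
      · simp [dyadicKernel]
    rw [hT, walsh_eq_mul_shift n]
    obtain h2 | h2 := Nat.mod_two_eq_zero_or_one n
    · have hD : dirichlet n x =
          (1 + rademacher 0 x) * dirichlet (n / 2) (fun j => x (j + 1)) := by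
        rw [← dirichlet_two_mul, show 2 * (n / 2) = n by omega]
      rw [hD, h2]
      push_cast
      ring
    · have hD := dirichlet_two_mul_add_one (n / 2) x
      rw [show 2 * (n / 2) + 1 = n by omega] at hD
      rw [hD, h2]
      push_cast
      linear_combination rademacher 0 x * hw +
        walsh (n / 2) (fun j => x (j + 1)) * dirichlet (n / 2) (fun j => x (j + 1)) * hr

/-- The pointwise bound of the Dirichlet kernel `D_n` by `V(n)` dyadic kernels. -/
lemma abs_dirichlet_le (n : ℕ) (x : G) :
    |dirichlet n x| ≤ (digit n 0 : ℝ) * dyadicKernel 0 x + ∑ k ∈ Finset.range n,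
      (((digit n (k + 1) : ℤ) - (digit n k : ℤ)).natAbs : ℝ) * dyadicKernel (k + 1) x := by
  -- Abel summation; at `K = n` the upper boundary term drops out because `n < 2 ^ n`.
  have abel : ∀ K, ∑ k ∈ Finset.range K,
      (digit n k : ℝ) * (dyadicKernel (k + 1) x - dyadicKernel k x) =
      (digit n K : ℝ) * dyadicKernel K x - (digit n 0 : ℝ) * dyadicKernel 0 x -
      ∑ k ∈ Finset.range K, ((digit n (k + 1) : ℝ) - digit n k) * dyadicKernel (k + 1) x := by
    intro K
    induction K with
    | zero => simp
    | succ K ih =>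
      rw [Finset.sum_range_succ, ih, Finset.sum_range_succ]
      ring
  have h : |dirichlet n x| = |walsh n x * dirichlet n x| := by rw [abs_mul, abs_walsh, one_mul]
  rw [h, walsh_mul_dirichlet Nat.lt_two_pow_self, abel, digit_eq_zero Nat.lt_two_pow_self,
    Nat.cast_zero, zero_mul, zero_sub, ← neg_add', abs_neg]
  refine (abs_add_le _ _).trans (add_le_add ?_ ((Finset.abs_sum_le_sum_abs _ _).trans
    (Finset.sum_le_sum fun k _ => ?_)))
  · rw [abs_of_nonneg (mul_nonneg (Nat.cast_nonneg _) (dyadicKernel_nonneg _ _))]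
  · rw [abs_mul, abs_of_nonneg (dyadicKernel_nonneg _ _), Nat.cast_natAbs]
    push_cast
    rfl

end Kernel

/-! ### Haar measure, digit flips and the dyadic filtration. -/

section Measure

lemma measure_singleton_half (a : ZMod 2) : μ₂ {a} = 2⁻¹ := by
  rw [μ₂, PMF.toMeasure_apply_singleton _ _ (measurableSet_singleton a),
    PMF.uniformOfFintype_apply, ZMod.card]
  rfl

lemma measure_I (n : ℕ) (x : G) : μ (I n x) = (2 ^ n)⁻¹ := by
  have h : I n x = Set.pi (Finset.range n) (fun j => {x j}) := by
    ext y; simp [I]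
  rw [h, μ, Measure.infinitePi_pi _ (fun _ _ => measurableSet_singleton _)]
  simp [measure_singleton_half, ENNReal.inv_pow]

lemma mem_I_self (n : ℕ) (x : G) : x ∈ I n x := fun _ _ => rfl

lemma I_eq_of_mem {n : ℕ} {x y : G} (h : y ∈ I n x) : I n y = I n x := by
  ext z
  exact ⟨fun hz j hj => (hz j hj).trans (h j hj), fun hz j hj => (hz j hj).trans (h j hj).symm⟩

lemma I_anti (x : G) : Antitone fun n => I n x :=
  fun _ _ hmn _ hy j hj => hy j (hj.trans_le hmn)

/-- Translation by the `m`-th unit vector. -/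
def flipDigit (m : ℕ) (x : G) : G := fun j => x j + if j = m then 1 else 0

lemma measurePreserving_flipDigit (m : ℕ) : MeasurePreserving (flipDigit m) μ μ := by
  refine ⟨measurable_pi_lambda _ fun j =>
    (measurable_of_countable (fun a : ZMod 2 => a + if j = m then 1 else 0)).comp
      (measurable_pi_apply j), ?_⟩
  have h := Measure.infinitePi_map_pi (μ := fun _ : ℕ => μ₂)
    (f := fun j (a : ZMod 2) => a + if j = m then 1 else 0) (fun _ => measurable_of_countable _)
  refine h.trans ?_
  rw [μ]
  congr 1
  funext j
  refine Measure.ext_of_singleton fun a => ?_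
  rw [Measure.map_apply (measurable_of_countable _) (measurableSet_singleton _)]
  have : (fun b : ZMod 2 => b + if j = m then 1 else 0) ⁻¹' {a} =
      {a - if j = m then 1 else 0} := by
    ext b; exact eq_sub_iff_add_eq.symm
  rw [this, measure_singleton_half, measure_singleton_half]

lemma rademacher_flipDigit_self (m : ℕ) (x : G) :
    rademacher m (flipDigit m x) = -rademacher m x := by
  have h : ∀ a : Fin 2, (if a + 1 = 0 then (1 : ℝ) else -1) = -(if a = 0 then 1 else -1) := by
    intro a
    fin_cases a <;> simp
  rw [rademacher_eq_ite, rademacher_eq_ite, show flipDigit m x m = x m + 1 by simp [flipDigit]]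
  exact h (x m)

lemma rademacher_flipDigit_of_ne {k m : ℕ} (h : k ≠ m) (x : G) :
    rademacher k (flipDigit m x) = rademacher k x := by
  simp [rademacher, flipDigit, h]

lemma flipDigit_mem_I (m : ℕ) (x : G) : flipDigit m x ∈ I m x := fun j hj => by
  simp [flipDigit, hj.ne]

/-- Invariance of `μ` under the flip makes the integral equal to its own negative. Both
orthogonality and the vanishing of conditional expectations rest on this. -/
lemma integral_eq_zero_of_flipDigit {E : Type*} [NormedAddCommGroup E] [NormedSpace ℝ E]
    {f : G → E} (m : ℕ) (hf : AEStronglyMeasurable f μ) (h : ∀ x, f (flipDigit m x) = -f x) :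
    ∫ x, f x ∂μ = 0 := by
  have h1 : ∫ x, f (flipDigit m x) ∂μ = ∫ x, f x ∂μ := by
    have hm := measurePreserving_flipDigit m
    rw [← integral_map hm.measurable.aemeasurable (by rwa [hm.map_eq]), hm.map_eq]
  simp only [h, integral_neg] at h1
  have h2 : (2 : ℝ) • ∫ x, f x ∂μ = 0 := by
    rw [two_smul]
    nth_rewrite 1 [← h1]
    exact neg_add_cancel _
  simpa using h2

lemma measurableSet_of_saturated {n : ℕ} {s : Set G} (h : ∀ x ∈ s, I n x ⊆ s) :
    MeasurableSet[ζ n] s := by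
  have : s = ⋃₀ (I n '' s) := by
    ext x
    constructor
    · exact fun hx => ⟨I n x, ⟨x, hx, rfl⟩, mem_I_self n x⟩
    · rintro ⟨_, ⟨y, hy, rfl⟩, hx⟩
      exact h y hy hx
  rw [this]
  refine MeasurableSet.sUnion
    ((finite_range_I n).subset (Set.image_subset_range _ _)).countable ?_
  rintro _ ⟨y, -, rfl⟩
  exact MeasurableSpace.measurableSet_generateFrom ⟨y, rfl⟩

/-- Converse of `measurableSet_of_saturated`: the members of `ζ n` are exactly the unions of
level-`n` intervals. -/
lemma saturated_of_measurableSet {n : ℕ} {s : Set G} (h : MeasurableSet[ζ n] s) {x y : G}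
    (hy : y ∈ I n x) : y ∈ s ↔ x ∈ s := by
  induction s, h using MeasurableSpace.generateFrom_induction generalizing x y with
  | hC t ht _ =>
    obtain ⟨z, rfl⟩ := ht
    exact ⟨fun h j hj => (hy j hj).symm.trans (h j hj), fun h j hj => (hy j hj).trans (h j hj)⟩
  | empty => simp
  | compl t _ ih => simp only [Set.mem_compl_iff, ih hy]
  | iUnion f _ ih => simp only [Set.mem_iUnion, ih _ hy]

lemma measurable_of_forall_mem_I {β : Type*} [MeasurableSpace β] {n : ℕ} {f : G → β}
    (h : ∀ x, ∀ y ∈ I n x, f y = f x) : Measurable[ζ n] f := fun s _ =>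
  measurableSet_of_saturated fun x hx y hy => by
    rw [Set.mem_preimage, h x y hy]; exact hx

lemma measurable_walsh {k n : ℕ} (h : k < 2 ^ n) : Measurable[ζ n] (walsh k) :=
  measurable_of_forall_mem_I fun _ _ hy => walsh_congr hy h

lemma measurable_walsh' (k : ℕ) : Measurable (walsh k) :=
  (measurable_walsh Nat.lt_two_pow_self).mono (ζ.le k) le_rfl

lemma measurable_rademacher (k : ℕ) : Measurable[ζ (k + 1)] (rademacher k) :=
  measurable_of_forall_mem_I fun _ _ hy => rademacher_congr hy k.lt_succ_self

lemma measurable_dyadicKernel (k : ℕ) : Measurable[ζ k] (dyadicKernel k) :=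
  measurable_of_forall_mem_I fun _ _ hy => Finset.prod_congr rfl fun _ hj => by
    rw [rademacher_congr hy (Finset.mem_range.1 hj)]

end Measure

/-! ### The dyadic maximal inequality. -/

section MaximalInequality

/-- The dyadic maximal function of `g`. -/
noncomputable def dyadicMaximal (g : G → ℝ≥0∞) (x : G) : ℝ≥0∞ :=
  ⨆ k : ℕ, 2 ^ k * ∫⁻ y in I k x, g y ∂μ

/-- The weak type `(1, 1)` inequality of the dyadic maximal function. -/
lemma mul_measure_lt_dyadicMaximal_le (g : G → ℝ≥0∞) (t : ℝ≥0) :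
    (t : ℝ≥0∞) * μ {x | (t : ℝ≥0∞) < dyadicMaximal g x} ≤ ∫⁻ x, g x ∂μ := by
  classical
  set s : Set G := {x | (t : ℝ≥0∞) < dyadicMaximal g x} with hs
  set P : G → ℕ → Prop := fun x k => (t : ℝ≥0∞) < 2 ^ k * ∫⁻ y in I k x, g y ∂μ with hP
  have hex : ∀ x ∈ s, ∃ k, P x k := fun x hx => lt_iSup_iff.1 hx
  -- The stopping intervals: the largest dyadic intervals on which the average of `g` exceeds `t`.
  set S : Set (Set G) := {c | ∃ x k, c = I k x ∧ P x k ∧ ∀ j < k, ¬P x j} with hS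
  have hcount : S.Countable := by
    refine (Set.countable_iUnion fun k => (finite_range_I k).countable).mono ?_
    rintro _ ⟨x, k, rfl, -⟩
    exact Set.mem_iUnion.2 ⟨k, x, rfl⟩
  have hmeas : ∀ c ∈ S, MeasurableSet c := by
    rintro _ ⟨x, k, rfl, -⟩
    exact measurableSet_I k x
  have hcover : s ⊆ ⋃₀ S := fun x hx =>
    ⟨I (Nat.find (hex x hx)) x, ⟨x, _, rfl, Nat.find_spec (hex x hx),
      fun j hj => Nat.find_min (hex x hx) hj⟩, mem_I_self _ x⟩
  have hdisj : S.Pairwise Disjoint := by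
    rintro _ ⟨x, k, rfl, hx, hx'⟩ _ ⟨y, l, rfl, hy, hy'⟩ hne
    rw [Set.disjoint_left]
    intro z hzx hzy
    have hPx : ∀ j ≤ k, P x j ↔ P z j := fun j hj => by
      simp only [hP, I_eq_of_mem (I_anti x hj hzx)]
    have hPy : ∀ j ≤ l, P y j ↔ P z j := fun j hj => by
      simp only [hP, I_eq_of_mem (I_anti y hj hzy)]
    -- Intervals sharing a point `z` have the same ancestors as `z`, so both levels are the first at
    -- which `P z` holds.
    have hkl : k = l := by
      rcases lt_trichotomy k l with h | h | h
      · exact absurd ((hPy k h.le).2 ((hPx k le_rfl).1 hx)) (hy' k h)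
      · exact h
      · exact absurd ((hPx l h.le).2 ((hPy l le_rfl).1 hy)) (hx' l h)
    subst hkl
    exact hne ((I_eq_of_mem hzx).symm.trans (I_eq_of_mem hzy))
  calc (t : ℝ≥0∞) * μ s ≤ t * μ (⋃₀ S) := by gcongr
    _ = ∑' c : S, (t : ℝ≥0∞) * μ c := by
      rw [measure_sUnion hcount hdisj hmeas, ENNReal.tsum_mul_left]
    -- Passing to the measure `g dμ` gives additivity over the intervals with no measurability of
    -- `g`.
    _ ≤ ∑' c : S, μ.withDensity g c := by
      refine ENNReal.tsum_le_tsum ?_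
      rintro ⟨_, x, k, rfl, hx, -⟩
      rw [withDensity_apply _ (measurableSet_I k x), measure_I, ← div_eq_mul_inv]
      exact ENNReal.div_le_of_le_mul' hx.le
    _ = μ.withDensity g (⋃₀ S) := (measure_sUnion hcount hdisj hmeas).symm
    _ ≤ μ.withDensity g Set.univ := measure_mono (Set.subset_univ _)
    _ = ∫⁻ x, g x ∂μ := by rw [withDensity_apply _ MeasurableSet.univ, Measure.restrict_univ]

end MaximalInequality

/-! ### Partial sums of martingales and the weak type estimate. -/

section PartialSums

variable {𝕜 : Type*} [RCLike 𝕜]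

lemma norm_coe_walsh (k : ℕ) (x : G) : ‖(walsh k x : 𝕜)‖ = 1 := by
  rw [RCLike.norm_ofReal, abs_walsh]

lemma measurable_coe_walsh (k : ℕ) : Measurable fun x => (walsh k x : 𝕜) :=
  RCLike.measurable_ofReal.comp (measurable_walsh' k)

lemma integrable_mul_walsh {f : G → 𝕜} (hf : Integrable f μ) (k : ℕ) :
    Integrable (fun x => f x * (walsh k x : 𝕜)) μ :=
  hf.mul_bdd (c := 1) (measurable_coe_walsh k).aestronglyMeasurable
    (ae_of_all _ fun x => (norm_coe_walsh k x).le)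

/-- Since `w_k` is `ζ N`-measurable, conditioning on `ζ N` replaces `F n` by `F N`. Thus the limit
defining `fourierCoeff` is eventually constant. -/
lemma integral_mul_walsh_eq {F : ℕ → G → 𝕜} (hF : Martingale F ζ μ) {k N n : ℕ}
    (hk : k < 2 ^ N) (hn : N ≤ n) :
    ∫ x, F n x * (walsh k x : 𝕜) ∂μ = ∫ x, F N x * (walsh k x : 𝕜) ∂μ := by
  have hw : StronglyMeasurable[ζ N] (walsh k) := (measurable_walsh hk).stronglyMeasurable
  have hsmul : ∀ n, (fun x => F n x * (walsh k x : 𝕜)) = walsh k • F n := fun n => by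
    funext x
    simp [RCLike.real_smul_eq_coe_mul, mul_comm]
  have hint : Integrable (walsh k • F n) μ := hsmul n ▸ integrable_mul_walsh (hF.integrable n) k
  rw [hsmul, hsmul, ← integral_condExp (ζ.le N)]
  refine integral_congr_ae ?_
  filter_upwards [condExp_smul_of_aestronglyMeasurable_left hw.aestronglyMeasurable hint
    (hF.integrable n), hF.condExp_ae_eq hn] with x h1 h2
  rw [h1, Pi.smul_apply', h2, Pi.smul_apply']

lemma fourierCoeff_eq {F : ℕ → G → 𝕜} (hF : Martingale F ζ μ) {k N : ℕ} (hk : k < 2 ^ N) :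
    fourierCoeff F k = ∫ x, F N x * (walsh k x : 𝕜) ∂μ := by
  refine Tendsto.limUnder_eq (tendsto_const_nhds.congr' ?_)
  filter_upwards [eventually_ge_atTop N] with n hn
  exact (integral_mul_walsh_eq hF hk hn).symm

/-- Convolution with the Dirichlet kernel; `x + y` plays the role of `x - y`, as every element of
`G` is its own negative. -/
lemma partialSum_eq_integral {F : ℕ → G → 𝕜} (hF : Martingale F ζ μ) {n N : ℕ}
    (hn : n ≤ 2 ^ N) (x : G) :
    partialSum n F x = ∫ y, F N y * (dirichlet n (x + y) : 𝕜) ∂μ := by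
  have h : ∀ y, F N y * (dirichlet n (x + y) : 𝕜) =
      ∑ k ∈ Finset.range n, F N y * (walsh k y : 𝕜) * (walsh k x : 𝕜) := fun y => by
    simp only [dirichlet, walsh_add, RCLike.ofReal_sum, RCLike.ofReal_mul, Finset.mul_sum]
    exact Finset.sum_congr rfl fun _ _ => by ring
  simp only [h]
  rw [integral_finsetSum _ fun k _ => (integrable_mul_walsh (hF.integrable N) k).mul_const _]
  refine Finset.sum_congr rfl fun k hk => ?_
  rw [integral_mul_const, fourierCoeff_eq hF ((Finset.mem_range.1 hk).trans_le hn)]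

lemma add_mem_I_zero {k : ℕ} {x y : G} : x + y ∈ I k 0 ↔ y ∈ I k x := by
  refine forall₂_congr fun j _ => ?_
  rw [Pi.add_apply, Pi.zero_apply, add_eq_zero_iff_neg_eq, ZMod.neg_eq_self_mod_two, eq_comm]

lemma lintegral_mul_dyadicKernel (g : G → ℝ≥0∞) (k : ℕ) (x : G) :
    ∫⁻ y, g y * ENNReal.ofReal (dyadicKernel k (x + y)) ∂μ = 2 ^ k * ∫⁻ y in I k x, g y ∂μ := by
  classical
  rw [← lintegral_const_mul' _ _ (by finiteness), ← lintegral_indicator (measurableSet_I k x)]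
  refine lintegral_congr fun y => ?_
  simp only [dyadicKernel_eq_ite, Set.indicator_apply, add_mem_I_zero]
  split_ifs
  · rw [mul_comm, ENNReal.ofReal_pow zero_le_two, ENNReal.ofReal_ofNat]
  · simp

lemma enorm_partialSum_le {F : ℕ → G → 𝕜} (hF : Martingale F ζ μ) (n : ℕ) (x : G) :
    ‖partialSum n F x‖ₑ ≤ V n * dyadicMaximal (fun y => ⨆ m, ‖F m y‖ₑ) x := by
  set M := dyadicMaximal (fun y => ⨆ m, ‖F m y‖ₑ) x with hM
  have hFm : Measurable fun y => ‖F n y‖ₑ :=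
    ((hF.1 n).mono (ζ.le n)).measurable.enorm
  -- Each dyadic kernel yields an average of `|F_n| ≤ F^*`, so one bound serves all `k` and `n`.
  have hterm : ∀ k, ∫⁻ y, ‖F n y‖ₑ * ENNReal.ofReal (dyadicKernel k (x + y)) ∂μ ≤ M := fun k => by
    rw [lintegral_mul_dyadicKernel]
    refine le_trans ?_ (le_iSup _ k)
    gcongr with y
    exact le_iSup (fun m => ‖F m y‖ₑ) n
  have hK : ∀ k, Measurable fun y => ENNReal.ofReal (dyadicKernel k (x + y)) := fun k =>
    (((measurable_dyadicKernel k).mono (ζ.le k) le_rfl).comp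
      (measurable_const_add x)).ennreal_ofReal
  have hmeas : ∀ k, Measurable fun y => ‖F n y‖ₑ * ENNReal.ofReal (dyadicKernel k (x + y)) :=
    fun k => hFm.mul (hK k)
  have hpt : ∀ y, ‖F n y * (dirichlet n (x + y) : 𝕜)‖ₑ ≤
      (digit n 0 : ℝ≥0∞) * (‖F n y‖ₑ * ENNReal.ofReal (dyadicKernel 0 (x + y))) +
      ∑ k ∈ Finset.range n, (((digit n (k + 1) : ℤ) - (digit n k : ℤ)).natAbs : ℝ≥0∞) *
        (‖F n y‖ₑ * ENNReal.ofReal (dyadicKernel (k + 1) (x + y))) := fun y => by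
    have h := ENNReal.ofReal_le_ofReal (abs_dirichlet_le n (x + y))
    have hnn : ∀ (c k : ℕ), 0 ≤ (c : ℝ) * dyadicKernel k (x + y) := fun c k =>
      mul_nonneg (Nat.cast_nonneg _) (dyadicKernel_nonneg _ _)
    rw [ENNReal.ofReal_add (hnn _ _) (Finset.sum_nonneg fun _ _ => hnn _ _),
      ENNReal.ofReal_sum_of_nonneg fun _ _ => hnn _ _] at h
    simp only [ENNReal.ofReal_mul (Nat.cast_nonneg _), ENNReal.ofReal_natCast] at h
    have hD : ‖(dirichlet n (x + y) : 𝕜)‖ₑ = ENNReal.ofReal |dirichlet n (x + y)| := by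
      rw [← ofReal_norm, RCLike.norm_ofReal]
    rw [enorm_mul, hD]
    refine (mul_le_mul_right h _).trans (le_of_eq ?_)
    rw [mul_add, Finset.mul_sum, mul_left_comm]
    congr 1
    exact Finset.sum_congr rfl fun _ _ => mul_left_comm _ _ _
  -- Level `N = n` suffices because `n ≤ 2 ^ n`.
  rw [partialSum_eq_integral hF Nat.lt_two_pow_self.le]
  calc _ ≤ ∫⁻ y, ‖F n y * (dirichlet n (x + y) : 𝕜)‖ₑ ∂μ := enorm_integral_le_lintegral_enorm _
    _ ≤ _ := lintegral_mono hpt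
    _ ≤ (digit n 0 : ℝ≥0∞) * M + ∑ k ∈ Finset.range n,
        (((digit n (k + 1) : ℤ) - (digit n k : ℤ)).natAbs : ℝ≥0∞) * M := by
      rw [lintegral_add_left ((hmeas 0).const_mul _),
        lintegral_finsetSum _ fun k _ => (hmeas (k + 1)).const_mul _,
        lintegral_const_mul _ (hmeas 0)]
      simp only [lintegral_const_mul _ (hmeas _)]
      gcongr <;> exact hterm _
    _ = V n * M := by
      rw [V, Nat.cast_add, Nat.cast_sum, add_mul, Finset.sum_mul]

lemma weakL1Norm_weightedMaximal_le (n : ℕ → ℕ) {F : ℕ → G → 𝕜} (hF : Martingale F ζ μ) :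
    weakL1Norm (weightedMaximal n F) ≤ hardyNorm F := by
  refine iSup_le fun t => le_trans ?_ (mul_measure_lt_dyadicMaximal_le _ t)
  gcongr with x
  refine iSup_le fun k => ?_
  exact ENNReal.div_le_of_le_mul' (enorm_partialSum_le hF (n k) x)

end PartialSums

/-! ### Unboundedness into `L_1`, tested on `D_{2^{m+1}} - D_{2^m}`. -/

section Counterexample

lemma digit_two_pow_add {m j : ℕ} (h : j < 2 ^ m) (k : ℕ) :
    digit (2 ^ m + j) k = digit j k + if k = m then 1 else 0 := by
  induction m generalizing j k with
  | zero =>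
    obtain rfl : j = 0 := by simpa using h
    cases k with
    | zero => simp [digit]
    | succ k => simp [digit_succ, digit_eq_zero]
  | succ m ih =>
    rw [pow_succ] at h ⊢
    cases k with
    | zero => simp [digit_zero]
    | succ k =>
      rw [digit_succ, digit_succ, show (2 ^ m * 2 + j) / 2 = 2 ^ m + j / 2 by omega,
        ih (by omega)]
      simp

lemma digit_two_pow (i k : ℕ) : digit (2 ^ i) k = if k = i then 1 else 0 := by
  have h := digit_two_pow_add (m := i) (j := 0) (by positivity) k
  rwa [add_zero, digit_eq_zero (n := 0) (by positivity), zero_add] at h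

/-- A digit `1` can create a jump only on either side of itself. -/
lemma V_le_two_mul_sum (n : ℕ) : V n ≤ 2 * ∑ k ∈ Finset.range (n + 1), digit n k := by
  have h1 : ∑ k ∈ Finset.range n, ((digit n (k + 1) : ℤ) - (digit n k : ℤ)).natAbs ≤
      ∑ k ∈ Finset.range n, digit n (k + 1) + ∑ k ∈ Finset.range n, digit n k := by
    rw [← Finset.sum_add_distrib]
    exact Finset.sum_le_sum fun k _ => by omega
  have h2 := Finset.sum_range_succ' (digit n) n
  have h3 := Finset.sum_range_succ (digit n) n
  unfold V
  omega

lemma V_two_pow_add_two_pow_le {i m : ℕ} (h : i < m) : V (2 ^ m + 2 ^ i) ≤ 4 := by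
  refine (V_le_two_mul_sum _).trans ?_
  simp only [digit_two_pow_add (Nat.pow_lt_pow_right one_lt_two h), digit_two_pow,
    Finset.sum_add_distrib, Finset.sum_ite_eq']
  split_ifs <;> simp

lemma walsh_two_pow_add {m j : ℕ} (h : j < 2 ^ m) (x : G) :
    walsh (2 ^ m + j) x = rademacher m x * walsh j x := by
  have h' : 2 ^ m + j < 2 ^ (m + 1) := by rw [pow_succ]; omega
  rw [walsh_eq_prod h', walsh_eq_prod (h.trans (Nat.pow_lt_pow_succ one_lt_two))]
  simp only [digit_two_pow_add h, pow_add, Finset.prod_mul_distrib]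
  rw [mul_comm]
  congr 1
  rw [Finset.prod_eq_single m]
  · simp
  · intro k _ hk
    simp [hk]
  · simp

lemma walsh_flipDigit (k j : ℕ) (x : G) :
    walsh k (flipDigit j x) = (-1) ^ digit k j * walsh k x := by
  have hk : k < 2 ^ (k + j + 1) :=
    Nat.lt_two_pow_self.trans_le (Nat.pow_le_pow_right two_pos (by omega))
  have hj : j ∈ Finset.range (k + j + 1) := Finset.mem_range.2 (by omega)
  rw [walsh_eq_prod hk, walsh_eq_prod hk, ← Finset.mul_prod_erase _ _ hj,
    ← Finset.mul_prod_erase _ _ hj, rademacher_flipDigit_self, neg_pow, mul_assoc]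
  congr 2
  refine Finset.prod_congr rfl fun i hi => ?_
  rw [rademacher_flipDigit_of_ne (Finset.ne_of_mem_erase hi)]

lemma exists_digit_ne {k l : ℕ} (h : k ≠ l) : ∃ j, digit k j ≠ digit l j := by
  by_contra! hc
  refine h (Nat.eq_of_testBit_eq fun j => ?_)
  have := hc j
  unfold digit at this
  rw [Nat.testBit_eq_decide_div_mod_eq, Nat.testBit_eq_decide_div_mod_eq, this]

lemma integral_walsh_mul_walsh (𝕜 : Type*) [RCLike 𝕜] (k l : ℕ) :
    ∫ x, (walsh l x : 𝕜) * (walsh k x : 𝕜) ∂μ = if k = l then 1 else 0 := by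
  split_ifs with h
  · subst h
    simp only [← RCLike.ofReal_mul, walsh_mul_self, RCLike.ofReal_one]
    simp
  -- Flipping a coordinate `j` at which the digits of `k` and `l` differ changes the sign of `w_l
  -- w_k`.
  · obtain ⟨j, hj⟩ := exists_digit_ne h
    refine integral_eq_zero_of_flipDigit j
      ((measurable_coe_walsh l).mul (measurable_coe_walsh k)).aestronglyMeasurable fun x => ?_
    rw [walsh_flipDigit, walsh_flipDigit, ← RCLike.ofReal_mul, ← RCLike.ofReal_mul,
      ← RCLike.ofReal_neg]
    congr 1
    have hs : (-1 : ℝ) ^ digit l j * (-1) ^ digit k j = -1 := by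
      have h1 : digit k j < 2 := Nat.mod_lt _ two_pos
      have h2 : digit l j < 2 := Nat.mod_lt _ two_pos
      rw [← pow_add, show digit l j + digit k j = 1 by omega, pow_one]
    linear_combination walsh l x * walsh k x * hs

lemma dirichlet_sub_dirichlet (m : ℕ) (x : G) :
    dirichlet (2 ^ (m + 1)) x - dirichlet (2 ^ m) x = rademacher m x * dyadicKernel m x := by
  rw [dirichlet_two_pow, dirichlet_two_pow, dyadicKernel, Finset.prod_range_succ]
  change dyadicKernel m x * _ - dyadicKernel m x = _
  ring

variable (𝕜 : Type*) [RCLike 𝕜]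

lemma dirichletDiff_martingale (m : ℕ) : Martingale (dirichletDiff 𝕜 m) ζ μ :=
  martingale_condExp _ _ _

lemma measurable_dirichletDiff_function (m : ℕ) : Measurable[ζ (m + 1)] fun x : G =>
    ((dirichlet (2 ^ (m + 1)) x - dirichlet (2 ^ m) x : ℝ) : 𝕜) := by
  simp only [dirichlet_sub_dirichlet]
  exact RCLike.measurable_ofReal.comp ((measurable_rademacher m).mul
    ((measurable_dyadicKernel m).mono (ζ.mono m.le_succ) le_rfl))

lemma enorm_dirichlet_sub_dirichlet (m : ℕ) (x : G) :
    ‖((dirichlet (2 ^ (m + 1)) x - dirichlet (2 ^ m) x : ℝ) : 𝕜)‖ₑ =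
      ENNReal.ofReal (dyadicKernel m x) := by
  rw [← ofReal_norm, RCLike.norm_ofReal, dirichlet_sub_dirichlet, abs_mul, ← walsh_two_pow,
    abs_walsh, one_mul, abs_of_nonneg (dyadicKernel_nonneg _ _)]

lemma lintegral_dyadicKernel (m : ℕ) : ∫⁻ x, ENNReal.ofReal (dyadicKernel m x) ∂μ = 1 := by
  have h := lintegral_mul_dyadicKernel 1 m 0
  simp only [Pi.one_apply, one_mul, zero_add, setLIntegral_const, measure_I] at h
  rw [h]
  exact ENNReal.mul_inv_cancel (by positivity) (by finiteness)

lemma integrable_dirichletDiff_function (m : ℕ) : Integrable (fun x : G =>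
    ((dirichlet (2 ^ (m + 1)) x - dirichlet (2 ^ m) x : ℝ) : 𝕜)) μ := by
  refine ⟨((measurable_dirichletDiff_function 𝕜 m).mono (ζ.le _) le_rfl).aestronglyMeasurable, ?_⟩
  simp only [HasFiniteIntegral, enorm_dirichlet_sub_dirichlet, lintegral_dyadicKernel,
    ENNReal.one_lt_top]

lemma dirichletDiff_of_lt {m n : ℕ} (h : m < n) : dirichletDiff 𝕜 m n =
    fun x => ((dirichlet (2 ^ (m + 1)) x - dirichlet (2 ^ m) x : ℝ) : 𝕜) :=
  condExp_of_stronglyMeasurable (ζ.le n)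
    ((measurable_dirichletDiff_function 𝕜 m).mono (ζ.mono h) le_rfl).stronglyMeasurable
    (integrable_dirichletDiff_function 𝕜 m)

/-- For `n ≤ m` the sets of `ζ n` are invariant under flipping coordinate `m`, whereas `r_m D_{2^m}`
changes sign; its integral over each of them vanishes. -/
lemma dirichletDiff_of_le {m n : ℕ} (h : n ≤ m) : dirichletDiff 𝕜 m n =ᵐ[μ] 0 := by
  refine (ae_eq_condExp_of_forall_setIntegral_eq (ζ.le n) (integrable_dirichletDiff_function 𝕜 m)
    (fun s _ _ => integrableOn_zero) (fun s hs _ => ?_) aestronglyMeasurable_zero).symm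
  have hs' := ζ.le n s hs
  simp only [integral_zero]
  rw [← integral_indicator hs']
  refine (integral_eq_zero_of_flipDigit m
    ((integrable_dirichletDiff_function 𝕜 m).indicator hs').aestronglyMeasurable fun x => ?_).symm
  have hmem : flipDigit m x ∈ s ↔ x ∈ s :=
    saturated_of_measurableSet hs (I_anti x h (flipDigit_mem_I m x))
  have hker : dyadicKernel m (flipDigit m x) = dyadicKernel m x :=
    Finset.prod_congr rfl fun k hk => by
      rw [rademacher_flipDigit_of_ne (Finset.mem_range.1 hk).ne]
  classical
  simp only [Set.indicator_apply, hmem, dirichlet_sub_dirichlet, hker, rademacher_flipDigit_self]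
  split_ifs <;> simp

/-- The martingale vanishes a.e. up to time `m` and equals `f_m` afterwards, so its maximal function
is `|f_m| = D_{2^m}` a.e. -/
lemma hardyNorm_dirichletDiff (m : ℕ) : hardyNorm (dirichletDiff 𝕜 m) = 1 := by
  rw [← lintegral_dyadicKernel m]
  have h0 : ∀ᵐ x ∂μ, ∀ n ≤ m, dirichletDiff 𝕜 m n x = 0 :=
    ae_all_iff.2 fun n => eventually_imp_distrib_left.2 fun hn => dirichletDiff_of_le 𝕜 hn
  refine lintegral_congr_ae ?_
  filter_upwards [h0] with x hx
  refine le_antisymm (iSup_le fun n => ?_) (le_iSup_of_le (m + 1) ?_)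
  · rcases le_or_gt n m with h | h
    · simp [hx n h]
    · rw [dirichletDiff_of_lt 𝕜 h, enorm_dirichlet_sub_dirichlet]
  · rw [dirichletDiff_of_lt 𝕜 m.lt_succ_self, enorm_dirichlet_sub_dirichlet]

lemma memH1_dirichletDiff (m : ℕ) : MemH1 (dirichletDiff 𝕜 m) :=
  ⟨dirichletDiff_martingale 𝕜 m, by rw [hardyNorm_dirichletDiff]; exact ENNReal.one_lt_top⟩

lemma fourierCoeff_dirichletDiff {m k : ℕ} (hk : k < 2 ^ (m + 1)) :
    fourierCoeff (dirichletDiff 𝕜 m) k = if 2 ^ m ≤ k then 1 else 0 := by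
  have hf : ∀ x, ((dirichlet (2 ^ (m + 1)) x - dirichlet (2 ^ m) x : ℝ) : 𝕜) * (walsh k x : 𝕜) =
      ∑ l ∈ Finset.Ico (2 ^ m) (2 ^ (m + 1)), (walsh l x : 𝕜) * (walsh k x : 𝕜) := fun x => by
    rw [dirichlet, dirichlet, ← Finset.sum_Ico_eq_sub _ (Nat.pow_le_pow_right two_pos m.le_succ),
      RCLike.ofReal_sum, Finset.sum_mul]
  rw [fourierCoeff_eq (dirichletDiff_martingale 𝕜 m) hk, dirichletDiff_of_lt 𝕜 m.lt_succ_self]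
  simp only [hf]
  have hint : ∀ l, Integrable (fun x => (walsh l x : 𝕜)) μ := fun l =>
    (integrable_const (1 : ℝ)).mono' (measurable_coe_walsh l).aestronglyMeasurable
      (ae_of_all _ fun x => (norm_coe_walsh l x).le)
  rw [integral_finsetSum _ fun l _ => integrable_mul_walsh (hint l) k]
  simp only [integral_walsh_mul_walsh, Finset.sum_ite_eq, Finset.mem_Ico, hk, and_true]

/-- The spectrum of `f_m` starts at `2^m`, so only the `2^i` frequencies `2^m + j` with `j < 2^i`
survive, and `w_{2^m+j} = r_m w_j`. -/
lemma partialSum_dirichletDiff {i m : ℕ} (h : i < m) (x : G) :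
    partialSum (2 ^ m + 2 ^ i) (dirichletDiff 𝕜 m) x =
      ((rademacher m x * dyadicKernel i x : ℝ) : 𝕜) := by
  have hi : 2 ^ i < 2 ^ m := Nat.pow_lt_pow_right one_lt_two h
  have hlow : ∑ k ∈ Finset.range (2 ^ m),
      fourierCoeff (dirichletDiff 𝕜 m) k * (walsh k x : 𝕜) = 0 := by
    refine Finset.sum_eq_zero fun k hk => ?_
    rw [Finset.mem_range] at hk
    rw [fourierCoeff_dirichletDiff 𝕜 (hk.trans (Nat.pow_lt_pow_succ one_lt_two)),
      if_neg hk.not_ge, zero_mul]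
  rw [partialSum, Finset.sum_range_add, hlow, zero_add, ← dirichlet_two_pow, dirichlet,
    Finset.mul_sum, RCLike.ofReal_sum]
  refine Finset.sum_congr rfl fun k hk => ?_
  rw [Finset.mem_range] at hk
  rw [fourierCoeff_dirichletDiff 𝕜 (by rw [pow_succ]; omega), if_pos (Nat.le_add_right _ _),
    one_mul, walsh_two_pow_add (hk.trans hi)]

lemma le_weightedMaximal_dirichletDiff {n : ℕ → ℕ} (hn : Set.range n = {m : ℕ | 0 < m})
    {i m : ℕ} (h : i < m) (x : G) :
    ENNReal.ofReal (dyadicKernel i x) / 4 ≤ weightedMaximal n (dirichletDiff 𝕜 m) x := by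
  obtain ⟨k, hk⟩ : 2 ^ m + 2 ^ i ∈ Set.range n := by
    rw [hn]
    exact Nat.add_pos_left (by positivity) _
  refine le_iSup_of_le k ?_
  rw [hk, partialSum_dirichletDiff 𝕜 h, ← ofReal_norm, RCLike.norm_ofReal, abs_mul,
    ← walsh_two_pow, abs_walsh, one_mul, abs_of_nonneg (dyadicKernel_nonneg _ _)]
  gcongr
  exact_mod_cast V_two_pow_add_two_pow_le h

lemma le_lintegral_weightedMaximal_dirichletDiff {n : ℕ → ℕ}
    (hn : Set.range n = {m : ℕ | 0 < m}) (m : ℕ) :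
    (m : ℝ≥0∞) * 8⁻¹ ≤ ∫⁻ x, weightedMaximal n (dirichletDiff 𝕜 m) x ∂μ := by
  -- `A i` is the shell `I_i(0) \ I_{i+1}(0)`: the first nonzero coordinate is the `i`-th.
  set A : ℕ → Set G := fun i => I (i + 1) (flipDigit i 0) with hA
  have hAm : ∀ i, MeasurableSet (A i) := fun i => measurableSet_I _ _
  have hsep : ∀ {i j : ℕ}, i < j → Disjoint (A i) (A j) := by
    intro i j hij
    rw [Set.disjoint_left]
    intro y hi hj
    have h1 := hi i i.lt_succ_self
    have h2 := hj i (hij.trans j.lt_succ_self)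
    rw [h1] at h2
    simp [flipDigit, hij.ne] at h2
  have hdisj : Set.PairwiseDisjoint (Finset.range m : Set ℕ) A := fun i _ j _ hij =>
    hij.lt_or_gt.elim (fun h => hsep h) fun h => (hsep h).symm
  have hpiece : ∀ i ∈ Finset.range m,
      (8⁻¹ : ℝ≥0∞) ≤ ∫⁻ x in A i, weightedMaximal n (dirichletDiff 𝕜 m) x ∂μ := by
    intro i hi
    -- The `8` is the `4` bounding `V` times the `2` from `μ (A i) = 2^{-(i+1)}`.
    calc (8⁻¹ : ℝ≥0∞) = 2 ^ i / 4 * μ (A i) := by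
          rw [hA, measure_I, pow_succ, ENNReal.mul_inv (by simp) (by simp), div_eq_mul_inv,
            mul_mul_mul_comm, mul_comm (4⁻¹ : ℝ≥0∞),
            ENNReal.mul_inv_cancel (by positivity) (by finiteness), one_mul,
            ← ENNReal.mul_inv (by simp) (by simp)]
          norm_num
      _ = ∫⁻ _ in A i, 2 ^ i / 4 ∂μ := (setLIntegral_const _ _).symm
      _ ≤ _ := by
          refine setLIntegral_mono' (hAm i) fun x hx => ?_
          refine le_trans ?_ (le_weightedMaximal_dirichletDiff 𝕜 hn (Finset.mem_range.1 hi) x)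
          have hx0 : x ∈ I i 0 := by
            rw [← I_eq_of_mem (flipDigit_mem_I i 0)]
            exact I_anti _ i.le_succ hx
          rw [dyadicKernel_eq_ite, Set.indicator_of_mem hx0, ENNReal.ofReal_pow zero_le_two,
            ENNReal.ofReal_ofNat]
  calc (m : ℝ≥0∞) * 8⁻¹ = ∑ _i ∈ Finset.range m, (8⁻¹ : ℝ≥0∞) := by simp
    _ ≤ ∑ i ∈ Finset.range m, ∫⁻ x in A i, weightedMaximal n (dirichletDiff 𝕜 m) x ∂μ :=
      Finset.sum_le_sum hpiece
    _ = ∫⁻ x in ⋃ i ∈ Finset.range m, A i, weightedMaximal n (dirichletDiff 𝕜 m) x ∂μ :=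
      (lintegral_biUnion_finset hdisj (fun i _ => hAm i) _).symm
    _ ≤ _ := setLIntegral_le_lintegral _ _

lemma tendsto_lintegral_weightedMaximal_dirichletDiff {n : ℕ → ℕ}
    (hn : Set.range n = {m : ℕ | 0 < m}) :
    Tendsto (fun m : ℕ => ∫⁻ x, weightedMaximal n (dirichletDiff 𝕜 m) x ∂μ) atTop (𝓝 ∞) := by
  refine tendsto_nhds_top_mono' ?_ fun m => le_lintegral_weightedMaximal_dirichletDiff 𝕜 hn m
  have h := ENNReal.Tendsto.mul_const (b := (8⁻¹ : ℝ≥0∞)) ENNReal.tendsto_nat_nhds_top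
    (Or.inl ENNReal.top_ne_zero)
  rwa [ENNReal.top_mul (by simp)] at h

end Counterexample

end WalshHardy

theorem theorem1 {𝕜 : Type*} [RCLike 𝕜] :
    (∃ C : ℝ≥0, ∀ n : ℕ → ℕ, (∀ k, 0 < n k) → ∀ F : ℕ → G → 𝕜, MemH1 F →
      weakL1Norm (weightedMaximal n F) ≤ (C : ℝ≥0∞) * hardyNorm F) ∧
    (∀ n : ℕ → ℕ, Set.range n = {m : ℕ | 0 < m} →
      (¬ ∃ C : ℝ≥0, ∀ F : ℕ → G → 𝕜, MemH1 F →
        ∫⁻ x, weightedMaximal n F x ∂μ ≤ (C : ℝ≥0∞) * hardyNorm F) ∧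
      (∀ m : ℕ, MemH1 (dirichletDiff 𝕜 m) ∧ 0 < hardyNorm (dirichletDiff 𝕜 m)) ∧
      Tendsto
        (fun m : ℕ => (∫⁻ x, weightedMaximal n (dirichletDiff 𝕜 m) x ∂μ) /
          hardyNorm (dirichletDiff 𝕜 m))
        atTop (𝓝 ∞)) := by
  refine ⟨⟨1, fun n _ F hF => ?_⟩, fun n hn => ⟨?_, fun m => ⟨memH1_dirichletDiff 𝕜 m, ?_⟩, ?_⟩⟩
  · rw [ENNReal.coe_one, one_mul]
    exact weakL1Norm_weightedMaximal_le n hF.1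
  · rintro ⟨C, hC⟩
    obtain ⟨m, hm⟩ := ((tendsto_lintegral_weightedMaximal_dirichletDiff 𝕜 hn).eventually
      (lt_mem_nhds (ENNReal.coe_lt_top (r := C)))).exists
    have h := hC _ (memH1_dirichletDiff 𝕜 m)
    rw [hardyNorm_dirichletDiff, mul_one] at h
    exact h.not_gt hm
  · rw [hardyNorm_dirichletDiff]
    exact one_pos
  · simpa only [hardyNorm_dirichletDiff, div_one] using
      tendsto_lintegral_weightedMaximal_dirichletDiff 𝕜 hn
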